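/- Let $G$ and $G'$ be commutative groups, written additively. For $p\colon G\to G'$ and $a\in G$ put $(D_a p)(b)=p(a+b)-p(b)$. Call $p$ a polynomial mapping of degree $\le 0$ if it is constant, and, for $d\ge 1$, a polynomial mapping of degree $\le d$ if $D_a p$ is a polynomial mapping of degree $\le d-1$ for every $a\in G$; call $p$ a polynomial mapping if it is one of degree $\le d$ for some $d\ge 0$. The IP-set generated by a sequence $(u_j)_{j\in\mathbb N}$ in $G$ is the set $\{\sum_{j\in\gamma}u_j : \gamma\subset\mathbb N,\ 0<|\gamma|<\infty\}$; a subset of $G$ is an IP*-set if it has nonempty intersection with every IP-set in $G$. Corollary 8.8. Let $p_1,\dots,p_k\colon G\to G'$ be polynomial mappings with $p_1(0)=\dots=p_k(0)=0$. For any finite coloring $\chi\colon G'\to\{1,\dots,r\}$ there is an $l$, $1\le l\le r$, such that the set $$R=\{g\in G : \text{there is } h\in G' \text{ such that } \chi(h+p_i(g))=l \text{ for all } i=1,\dots,k\}$$ is an IP*-set in $G$. -/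

import Mathlib

/-- `p : G → G'` is a polynomial mapping of degree `≤ d` between commutative groups: for `d = 0`
it is constant; for `d + 1`, every difference `b ↦ p (b + a) - p b`, `a ∈ G`, is a polynomial
mapping of degree `≤ d`. -/
def IsPolyMapOfDegreeLE {G G' : Type*} [AddCommGroup G] [AddCommGroup G'] :
    ℕ → (G → G') → Prop
  | 0, p => ∃ c : G', ∀ x : G, p x = c
  | d + 1, p => ∀ a : G, IsPolyMapOfDegreeLE d (fwdDiff a p)

/-- `p` is a polynomial mapping if it is one of degree `≤ d` for some `d`. -/
def IsPolyMap {G G' : Type*} [AddCommGroup G] [AddCommGroup G'] (p : G → G') : Prop :=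
  ∃ d : ℕ, IsPolyMapOfDegreeLE d p

/-- The IP-set generated by the sequence `u`: all finite nonempty sums of terms of `u` with
distinct indices. -/
def ipSet {G : Type*} [AddCommMonoid G] (u : ℕ → G) : Set G :=
  {x | ∃ γ : Finset ℕ, γ.Nonempty ∧ x = ∑ j ∈ γ, u j}

/-- `E` is an IP*-set if it has nonempty intersection with every IP-set. -/
def IsIPStar {G : Type*} [AddCommMonoid G] (E : Set G) : Prop :=
  ∀ u : ℕ → G, (E ∩ ipSet u).Nonempty

/-! ### Degrees of polynomial mappings -/

section PolynomialMaps

variable {G G' : Type*} [AddCommGroup G] [AddCommGroup G']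

/-! This is the color-focusing proof of the polynomial van der Waerden theorem, along IP-sets
(`IsIPRecurrent`). If every color `l` failed, with a bad IP-set generated by `u l`, pass to the
product group `Fin r → G` and the maps `p i (v l)`. Recurrence yields one index set `γ` serving all
colors at once, in particular the color of the base point `h`, a contradiction. Recurrence for a
family reduces, by `exists_focused`, to recurrence for the shifted family `shiftSub a p q`. If `q`
has least degree, this replaces one class of maps with equal leading behavior by classes of lower
degree, so the multiset of degrees decreases in a well-founded order. -/

theorem IsPolyMapOfDegreeLE.const (d : ℕ) (c : G') :
    IsPolyMapOfDegreeLE d (fun _ : G => c) := by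
  induction d generalizing c with
  | zero => exact ⟨c, fun _ => rfl⟩
  | succ d ih =>
    intro a
    have h : fwdDiff a (fun _ : G => c) = fun _ => (0 : G') := by
      funext b; simp [fwdDiff]
    rw [h]
    exact ih 0

theorem IsPolyMapOfDegreeLE.sub {d : ℕ} {p q : G → G'} (hp : IsPolyMapOfDegreeLE d p)
    (hq : IsPolyMapOfDegreeLE d q) : IsPolyMapOfDegreeLE d (p - q) := by
  induction d generalizing p q with
  | zero =>
    obtain ⟨c, hc⟩ := hp
    obtain ⟨c', hc'⟩ := hq
    exact ⟨c - c', fun x => by simp [hc, hc']⟩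
  | succ d ih =>
    intro a
    have h : fwdDiff a (p - q) = fwdDiff a p - fwdDiff a q := by
      funext b; simp only [fwdDiff, Pi.sub_apply]; abel
    rw [h]
    exact ih (hp a) (hq a)

theorem IsPolyMapOfDegreeLE.add {d : ℕ} {p q : G → G'} (hp : IsPolyMapOfDegreeLE d p)
    (hq : IsPolyMapOfDegreeLE d q) : IsPolyMapOfDegreeLE d (p + q) := by
  have h : p + q = p - ((fun _ => 0) - q) := by funext b; simp
  rw [h]
  exact hp.sub ((IsPolyMapOfDegreeLE.const d 0).sub hq)

theorem IsPolyMapOfDegreeLE.succ {d : ℕ} {p : G → G'} (hp : IsPolyMapOfDegreeLE d p) :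
    IsPolyMapOfDegreeLE (d + 1) p := by
  induction d generalizing p with
  | zero =>
    obtain ⟨c, hc⟩ := hp
    obtain rfl : p = fun _ => c := funext hc
    exact .const 1 c
  | succ d ih => exact fun a => ih (hp a)

theorem IsPolyMapOfDegreeLE.mono {d e : ℕ} {p : G → G'} (hp : IsPolyMapOfDegreeLE d p)
    (hde : d ≤ e) : IsPolyMapOfDegreeLE e p := by
  induction hde with
  | refl => exact hp
  | step _ ih => exact ih.succ

theorem IsPolyMapOfDegreeLE.comp_addMonoidHom {H : Type*} [AddCommGroup H] {d : ℕ} {p : G → G'}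
    (hp : IsPolyMapOfDegreeLE d p) (f : H →+ G) : IsPolyMapOfDegreeLE d (fun x => p (f x)) := by
  induction d generalizing p with
  | zero =>
    obtain ⟨c, hc⟩ := hp
    exact ⟨c, fun x => hc _⟩
  | succ d ih =>
    intro a
    have h : fwdDiff a (fun x => p (f x)) = fun x => fwdDiff (f a) p (f x) := by
      funext b; simp [fwdDiff]
    rw [h]
    exact ih (hp (f a))

/-- The mapping `g ↦ p (a + g) - p a - q g`, which vanishes at `0` when `q` does. -/
def shiftSub (a : G) (p q : G → G') : G → G' := fun g => p (a + g) - p a - q g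

theorem shiftSub_eq (a : G) (p q : G → G') :
    shiftSub a p q = fwdDiff a p + (p - q) - fun _ => p a := by
  funext b
  simp only [shiftSub, fwdDiff, Pi.add_apply, Pi.sub_apply, add_comm a b]
  abel

/-- Differencing lowers the degree of `p`, and `p - q` is already low, so maps that agree to top
order drop in degree. -/
theorem IsPolyMapOfDegreeLE.shiftSub {d : ℕ} {p q : G → G'}
    (hp : IsPolyMapOfDegreeLE (d + 1) p) (hpq : IsPolyMapOfDegreeLE d (p - q)) (a : G) :
    IsPolyMapOfDegreeLE d (shiftSub a p q) := by
  rw [shiftSub_eq]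
  exact ((hp a).add hpq).sub (.const d _)

theorem IsPolyMapOfDegreeLE.eq_zero {p : G → G'} (hp : IsPolyMapOfDegreeLE 0 p) (h0 : p 0 = 0) :
    p = 0 := by
  obtain ⟨c, hc⟩ := hp
  funext x
  rw [hc, ← hc 0, h0, Pi.zero_apply]

end PolynomialMaps

/-! ### Color focusing along IP-sets -/

section Recurrence

variable {G G' : Type*} [AddCommGroup G] [AddCommGroup G']

/-- The sums of `u` over nonempty subsets of `{0, …, N - 1}`. -/
def initialSums (u : ℕ → G) (N : ℕ) : Set G :=
  {x | ∃ γ : Finset ℕ, γ ⊆ Finset.range N ∧ γ.Nonempty ∧ x = ∑ j ∈ γ, u j}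

theorem finite_initialSums (u : ℕ → G) (N : ℕ) : (initialSums u N).Finite := by
  refine ((Finset.range N).powerset.finite_toSet.image (fun γ => ∑ j ∈ γ, u j)).subset ?_
  rintro x ⟨γ, hγ, -, rfl⟩
  exact ⟨γ, Finset.mem_coe.2 (Finset.mem_powerset.2 hγ), rfl⟩

theorem initialSums_mono (u : ℕ → G) {N M : ℕ} (h : N ≤ M) :
    initialSums u N ⊆ initialSums u M := by
  rintro x ⟨γ, hγ, hne, rfl⟩
  exact ⟨γ, hγ.trans (Finset.range_mono h), hne, rfl⟩

/-- The two sums use disjoint blocks of indices, below `N` and from `N` on. -/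
theorem add_mem_initialSums {u : ℕ → G} {N M : ℕ} {a g : G} (ha : a ∈ insert 0 (initialSums u N))
    (hg : g ∈ initialSums (fun j => u (N + j)) M) : a + g ∈ initialSums u (N + M) := by
  classical
  obtain ⟨γ, hγ, hne, rfl⟩ := hg
  have key : ∀ δ : Finset ℕ, δ ⊆ Finset.range N →
      ∑ j ∈ δ, u j + ∑ j ∈ γ, u (N + j) ∈ initialSums u (N + M) := by
    intro δ hδ
    refine ⟨δ ∪ γ.map (addLeftEmbedding N), ?_, ?_, ?_⟩
    · intro j hj
      simp only [Finset.mem_union, Finset.mem_map, addLeftEmbedding_apply] at hj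
      rcases hj with hj | ⟨i, hi, rfl⟩
      · have := Finset.mem_range.1 (hδ hj)
        exact Finset.mem_range.2 (by omega)
      · have := Finset.mem_range.1 (hγ hi)
        exact Finset.mem_range.2 (by omega)
    · exact (hne.map).mono Finset.subset_union_right
    · rw [Finset.sum_union, Finset.sum_map]
      · rfl
      · rw [Finset.disjoint_left]
        intro j hj hj'
        simp only [Finset.mem_map, addLeftEmbedding_apply] at hj'
        obtain ⟨i, -, rfl⟩ := hj'
        have := Finset.mem_range.1 (hδ hj)
        omega
  rcases ha with rfl | ⟨δ, hδ, -, rfl⟩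
  · simpa using key ∅ (by simp)
  · exact key δ hδ

/-- Every finite coloring of `G'` has a monochromatic configuration `{h} ∪ {h + p g : p ∈ A}` with
`g` in a prescribed IP-set, where `h` and `g` range over finite sets that depend only on the
number of colors and on the IP-set. -/
def IsIPRecurrent (A : Set (G → G')) : Prop :=
  ∀ (r : ℕ) (u : ℕ → G), ∃ (N : ℕ) (F : Set G'), F.Finite ∧ ∀ χ : G' → Fin r,
    ∃ h ∈ F, ∃ g ∈ initialSums u N, ∀ p ∈ A, χ (h + p g) = χ h

/-- Color focusing. -/
theorem exists_focused {A : Set (G → G')} (hA : A.Finite) (q : G → G')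
    (hred : ∀ D : Set G, D.Finite →
      IsIPRecurrent {p' : G → G' | ∃ p ∈ A, ∃ a ∈ D, p' = shiftSub a p q})
    (h0 : ∀ p ∈ A, p 0 = 0) (r : ℕ) (u : ℕ → G) (s : ℕ) :
    ∃ (N : ℕ) (F : Set G'), F.Finite ∧ ∀ χ : G' → Fin r,
      (∃ h ∈ F, ∃ g ∈ initialSums u N, ∀ p ∈ A, χ (h + p g) = χ h) ∨
      ∃ x ∈ F, ∃ C : Finset (Fin r), C.card = s ∧
        ∀ c ∈ C, ∃ g ∈ initialSums u N, ∀ p ∈ A, χ (x + p g) = c := by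
  classical
  induction s with
  | zero =>
    exact ⟨0, {0}, Set.finite_singleton 0, fun χ => Or.inr ⟨0, rfl, ∅, rfl, by simp⟩⟩
  | succ s ih =>
    obtain ⟨N, F, hF, ih⟩ := ih
    set D : Set G := insert 0 (initialSums u N) with hD
    have hDfin : D.Finite := (finite_initialSums u N).insert 0
    set E : Set G' := F ∪ (fun t : G' × (G → G') × G => t.1 + t.2.1 t.2.2) '' (F ×ˢ A ×ˢ D)
      with hE
    have hEfin : E.Finite := hF.union ((hF.prod (hA.prod hDfin)).image _)
    have : Fintype E := hEfin.fintype
    let e := Fintype.equivFin (E → Fin r)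
    -- A point `y` is now colored by the whole pattern of `χ` on `y + E`; finiteness of `E` keeps
    -- the number of colors finite.
    obtain ⟨M, F', hF', hM⟩ := hred D hDfin (Fintype.card (E → Fin r)) (fun j => u (N + j))
    have hgfin := finite_initialSums (fun j => u (N + j)) M
    refine ⟨N + M, ((fun t : G' × G' => t.1 + t.2) '' (F' ×ˢ F)) ∪
      ((fun t : G' × G' × G => t.1 + t.2.1 - q t.2.2) ''
        (F' ×ˢ F ×ˢ initialSums (fun j => u (N + j)) M)),
      ((hF'.prod hF).image _).union ((hF'.prod (hF.prod hgfin)).image _), fun χ => ?_⟩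
    obtain ⟨y, hy, g, hg, hmono⟩ := hM (fun y => e fun f => χ (y + f))
    have hmono' : ∀ f ∈ E, ∀ p ∈ A, ∀ a ∈ D, χ (y + shiftSub a p q g + f) = χ (y + f) := by
      intro f hf p hp a ha
      exact congrFun (e.injective (hmono _ ⟨p, hp, a, ha, rfl⟩)) ⟨f, hf⟩
    have hsub := initialSums_mono u (Nat.le_add_right N M)
    have hxmem : ∀ x ∈ F, y + x ∈ ((fun t : G' × G' => t.1 + t.2) '' (F' ×ˢ F)) :=
      fun x hx => ⟨(y, x), ⟨hy, hx⟩, rfl⟩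
    rcases ih (fun z => χ (y + z)) with ⟨x, hx, a, ha, hxa⟩ | ⟨x, hx, C, hC, hCx⟩
    · exact Or.inl ⟨y + x, Or.inl (hxmem x hx), a, hsub ha, fun p hp => by
        rw [add_assoc]; exact hxa p hp⟩
    · by_cases hmem : χ (y + x) ∈ C
      · obtain ⟨a, ha, hxa⟩ := hCx _ hmem
        exact Or.inl ⟨y + x, Or.inl (hxmem x hx), a, hsub ha, fun p hp => by
          rw [add_assoc]; exact hxa p hp⟩
      -- The new focus satisfies `(y + x - q g) + p (a + g) = (y + shiftSub a p q g) + (x + p a)`,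
      -- which has the color of `y + (x + p a)`. Old `a` keep the old colors; `a = 0` adds the color
      -- of `y + x`.
      · refine Or.inr ⟨y + x - q g, Or.inr ⟨(y, x, g), ⟨hy, hx, hg⟩, rfl⟩,
          insert (χ (y + x)) C, by rw [Finset.card_insert_of_notMem hmem, hC], ?_⟩
        have hstep : ∀ p ∈ A, ∀ a ∈ D,
            χ (y + x - q g + p (a + g)) = χ (y + (x + p a)) := by
          intro p hp a ha
          rw [← hmono' (x + p a) (Or.inr ⟨(x, p, a), ⟨hx, hp, ha⟩, rfl⟩) p hp a ha]
          congr 1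
          simp only [shiftSub]
          abel
        intro c hc
        rcases Finset.mem_insert.1 hc with rfl | hc
        · refine ⟨0 + g, add_mem_initialSums (Set.mem_insert _ _) hg, fun p hp => ?_⟩
          rw [hstep p hp 0 (Set.mem_insert _ _), h0 p hp, add_zero]
        · obtain ⟨a, ha, hxa⟩ := hCx c hc
          refine ⟨a + g, add_mem_initialSums (Set.mem_insert_of_mem _ ha) hg, fun p hp => ?_⟩
          rw [hstep p hp a (Set.mem_insert_of_mem _ ha)]
          exact hxa p hp

theorem IsIPRecurrent.of_shiftSub {A : Set (G → G')} (hA : A.Finite) (q : G → G')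
    (hred : ∀ D : Set G, D.Finite →
      IsIPRecurrent {p' : G → G' | ∃ p ∈ A, ∃ a ∈ D, p' = shiftSub a p q})
    (h0 : ∀ p ∈ A, p 0 = 0) : IsIPRecurrent A := by
  intro r u
  -- Only `r` colors exist, so `r + 1` focused ones are impossible.
  obtain ⟨N, F, hF, h⟩ := exists_focused hA q hred h0 r u (r + 1)
  refine ⟨N, F, hF, fun χ => (h χ).resolve_right ?_⟩
  rintro ⟨x, -, C, hC, -⟩
  have := C.card_le_univ
  rw [hC, Fintype.card_fin] at this
  omega

theorem isIPRecurrent_of_subset_zero {A : Set (G → G')} (hA : ∀ p ∈ A, p = 0) :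
    IsIPRecurrent A := by
  intro r u
  refine ⟨1, {0}, Set.finite_singleton 0, fun χ => ⟨0, rfl, u 0, ⟨{0}, by simp, by simp, by simp⟩,
    fun p hp => ?_⟩⟩
  simp [hA p hp]

/-- The zero map imposes no condition. It must be set aside since a PET cover ignores it. -/
theorem IsIPRecurrent.of_diff_zero {A : Set (G → G')} (h : IsIPRecurrent (A \ {0})) :
    IsIPRecurrent A := by
  intro r u
  obtain ⟨N, F, hF, h⟩ := h r u
  refine ⟨N, F, hF, fun χ => ?_⟩
  obtain ⟨x, hx, g, hg, hxg⟩ := h χ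
  refine ⟨x, hx, g, hg, fun p hp => ?_⟩
  by_cases hp0 : p = 0
  · simp [hp0]
  · exact hxg p ⟨hp, hp0⟩

/-! ### PET induction on degrees -/

/-- Each nonzero member of `A` agrees, up to a mapping of degree `≤ e`, with a representative of
degree `≤ e + 1` listed as `(representative, e)` in `L`. -/
structure IsPETCover (A : Set (G → G')) (L : Multiset ((G → G') × ℕ)) : Prop where
  isPoly : ∀ x ∈ L, IsPolyMapOfDegreeLE (x.2 + 1) x.1
  map_zero : ∀ p ∈ A, p 0 = 0
  cover : ∀ p ∈ A, p ≠ 0 → ∃ x ∈ L, IsPolyMapOfDegreeLE x.2 (p - x.1)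

/-- Polynomial exhaustion: subtracting a member of a class of least degree replaces this class by
finitely many classes of smaller degree. -/
theorem IsPETCover.exists_shiftSub {A : Set (G → G')} (hA : A.Finite)
    {x : (G → G') × ℕ} {L : Multiset ((G → G') × ℕ)} (h : IsPETCover A (x ::ₘ L))
    (hmin : ∀ z ∈ L, x.2 ≤ z.2) {q : G → G'} (hq : q ∈ A)
    (hqx : IsPolyMapOfDegreeLE x.2 (q - x.1)) (hne : ∀ p ∈ A, p ≠ 0) {D : Set G}
    (hD : D.Finite) :
    ∃ L' : Multiset ((G → G') × ℕ),
      IsPETCover {p' : G → G' | ∃ p ∈ A, ∃ a ∈ D, p' = shiftSub a p q} L' ∧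
      Relation.CutExpand (· < ·) (L'.map Prod.snd) ((x ::ₘ L).map Prod.snd) := by
  classical
  set A' : Set (G → G') := {p' | ∃ p ∈ A, ∃ a ∈ D, p' = shiftSub a p q} with hA'
  have hA'fin : A'.Finite := by
    refine ((hA.prod hD).image fun t => shiftSub t.2 t.1 q).subset ?_
    rintro _ ⟨p, hp, a, ha, rfl⟩
    exact ⟨(p, a), ⟨hp, ha⟩, rfl⟩
  have hx := h.isPoly x (Multiset.mem_cons_self x L)
  have hqpoly : IsPolyMapOfDegreeLE (x.2 + 1) q := by
    simpa using hqx.succ.add hx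
  have hq0 : q 0 = 0 := h.map_zero q hq
  obtain ⟨low, hlow, hlow', hlt⟩ : ∃ low : Multiset ((G → G') × ℕ),
      (∀ z ∈ low, IsPolyMapOfDegreeLE (z.2 + 1) z.1) ∧
      (∀ p ∈ A', p ≠ 0 → IsPolyMapOfDegreeLE x.2 p →
        ∃ z ∈ low, IsPolyMapOfDegreeLE z.2 (p - z.1)) ∧ ∀ z ∈ low, z.2 < x.2 := by
    -- In degree 0 the shifted maps are constants vanishing at 0, so they need no class; otherwise
    -- each represents itself, one degree lower.
    obtain he | ⟨e, he⟩ : x.2 = 0 ∨ ∃ e, x.2 = e + 1 := by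
      cases x.2 <;> simp
    · refine ⟨0, by simp, ?_, by simp⟩
      rintro _ ⟨p, hp, a, ha, rfl⟩ hne hpoly
      rw [he] at hpoly
      refine absurd (hpoly.eq_zero ?_) hne
      simp [shiftSub, hq0]
    · have hB : (A' ∩ {p | IsPolyMapOfDegreeLE x.2 p}).Finite := hA'fin.inter_of_left _
      refine ⟨hB.toFinset.val.map fun p => (p, e), ?_, ?_, ?_⟩
      · intro z hz
        obtain ⟨p, hp, rfl⟩ := Multiset.mem_map.1 hz
        have hp' := (hB.mem_toFinset.1 hp).2
        rwa [Set.mem_ofPred_eq, he] at hp'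
      · intro p hp _ hpoly
        refine ⟨(p, e), Multiset.mem_map.2 ⟨p, hB.mem_toFinset.2 ⟨hp, hpoly⟩, rfl⟩, ?_⟩
        rw [sub_self]
        exact .const e 0
      · intro z hz
        obtain ⟨p, -, rfl⟩ := Multiset.mem_map.1 hz
        rw [he]
        exact Nat.lt_succ_self e
  -- The other classes survive with their representatives translated by `q`; minimality of `x.2`
  -- keeps the degree bounds.
  refine ⟨L.map (fun z => (z.1 - q, z.2)) + low, ⟨?_, ?_, ?_⟩, ?_⟩
  · intro z hz
    rcases Multiset.mem_add.1 hz with hz | hz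
    · obtain ⟨w, hw, rfl⟩ := Multiset.mem_map.1 hz
      exact (h.isPoly w (Multiset.mem_cons_of_mem hw)).sub
        (hqpoly.mono (Nat.succ_le_succ (hmin w hw)))
    · exact hlow z hz
  · rintro _ ⟨p, hp, a, ha, rfl⟩
    simp [shiftSub, hq0]
  · rintro _ ⟨p, hp, a, ha, rfl⟩ hp'
    obtain ⟨w, hw, hpw⟩ := h.cover p hp (hne p hp)
    have hppoly : IsPolyMapOfDegreeLE (w.2 + 1) p := by
      simpa using hpw.succ.add (h.isPoly w hw)
    rcases Multiset.mem_cons.1 hw with rfl | hwL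
    · have hpq : IsPolyMapOfDegreeLE w.2 (p - q) := by
        simpa using hpw.sub hqx
      obtain ⟨z, hz, hz'⟩ := hlow' _ ⟨p, hp, a, ha, rfl⟩ hp' (hppoly.shiftSub hpq a)
      exact ⟨z, Multiset.mem_add.2 (Or.inr hz), hz'⟩
    · refine ⟨(w.1 - q, w.2), Multiset.mem_add.2 (Or.inl (Multiset.mem_map.2 ⟨w, hwL, rfl⟩)), ?_⟩
      have heq : shiftSub a p q - (w.1 - q) = shiftSub a p w.1 := by
        funext b
        simp only [shiftSub, Pi.sub_apply]
        abel
      rw [heq]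
      exact hppoly.shiftSub hpw a
  · refine ⟨low.map Prod.snd, x.2, ?_, ?_⟩
    · intro e he
      obtain ⟨z, hz, rfl⟩ := Multiset.mem_map.1 he
      exact hlt z hz
    · simp only [Multiset.map_add, Multiset.map_map, Function.comp_def,
        ← Multiset.singleton_add]
      abel

theorem IsPETCover.isIPRecurrent {A : Set (G → G')} (hA : A.Finite)
    {L : Multiset ((G → G') × ℕ)} (h : IsPETCover A L) : IsIPRecurrent A := by
  classical
  have hwf : WellFounded (Relation.CutExpand ((· < ·) : ℕ → ℕ → Prop)) :=
    WellFounded.cutExpand Nat.lt_wfRel.wf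
  obtain ⟨m, hm⟩ : ∃ m, m = L.map Prod.snd := ⟨_, rfl⟩
  induction m using hwf.induction generalizing A L with
  | _ m ih =>
    subst hm
    rcases L.empty_or_exists_mem with rfl | hL
    · refine isIPRecurrent_of_subset_zero fun p hp => by_contra fun hp0 => ?_
      obtain ⟨x, hx, -⟩ := h.cover p hp hp0
      simp at hx
    · obtain ⟨x, hxL, hmin⟩ := Multiset.exists_min_image Prod.snd
        (s := L) (Multiset.card_pos_iff_exists_mem.2 hL |> Multiset.card_pos.1)
      obtain ⟨L, rfl⟩ := Multiset.exists_cons_of_mem hxL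
      by_cases hq : ∃ q ∈ A \ {0}, IsPolyMapOfDegreeLE x.2 (q - x.1)
      · obtain ⟨q, hq, hqx⟩ := hq
        have hA' : (A \ {0}).Finite := hA.sdiff
        have h' : IsPETCover (A \ {0}) (x ::ₘ L) :=
          ⟨h.isPoly, fun p hp => h.map_zero p hp.1, fun p hp => h.cover p hp.1⟩
        refine (IsIPRecurrent.of_shiftSub hA' q (fun D hD => ?_) h'.map_zero).of_diff_zero
        obtain ⟨L', hL', hcut⟩ := h'.exists_shiftSub hA'
          (fun z hz => hmin z (Multiset.mem_cons_of_mem hz)) hq hqx (fun p hp => hp.2) hD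
        refine ih _ hcut ?_ hL' rfl
        refine ((hA'.prod hD).image fun t => shiftSub t.2 t.1 q).subset ?_
        rintro _ ⟨p, hp, a, ha, rfl⟩
        exact ⟨(p, a), ⟨hp, ha⟩, rfl⟩
      -- No nonzero map lies in the least class, so it is dropped.
      · refine ih (L.map Prod.snd) ?_ hA (L := L) ⟨fun z hz => h.isPoly z
          (Multiset.mem_cons_of_mem hz), h.map_zero, fun p hp hp0 => ?_⟩ rfl
        · refine ⟨0, x.2, by simp, ?_⟩
          rw [Multiset.map_cons, add_zero, ← Multiset.singleton_add, add_comm]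
        · obtain ⟨w, hw, hpw⟩ := h.cover p hp hp0
          rcases Multiset.mem_cons.1 hw with rfl | hw
          · exact absurd ⟨p, ⟨hp, hp0⟩, hpw⟩ hq
          · exact ⟨w, hw, hpw⟩

theorem isIPRecurrent_range {ι : Type*} [Finite ι] (p : ι → G → G') (hp : ∀ i, IsPolyMap (p i))
    (hp0 : ∀ i, p i 0 = 0) : IsIPRecurrent (Set.range p) := by
  have := Fintype.ofFinite ι
  choose d hd using hp
  refine IsPETCover.isIPRecurrent (Set.finite_range p)
    (L := Finset.univ.val.map fun i => (p i, d i)) ⟨?_, ?_, ?_⟩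
  · intro x hx
    obtain ⟨i, -, rfl⟩ := Multiset.mem_map.1 hx
    exact (hd i).succ
  · rintro _ ⟨i, rfl⟩
    exact hp0 i
  · rintro _ ⟨i, rfl⟩ -
    refine ⟨(p i, d i), Multiset.mem_map.2 ⟨i, Finset.mem_univ_val i, rfl⟩, ?_⟩
    rw [sub_self]
    exact .const _ 0

end Recurrence

theorem corollary8p8 {G G' : Type*} [AddCommGroup G] [AddCommGroup G'] {k : ℕ}
    (p : Fin k → G → G') (hp : ∀ i, IsPolyMap (p i)) (hp0 : ∀ i, p i 0 = 0)
    {r : ℕ} (χ : G' → Fin r) :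
    ∃ l : Fin r, IsIPStar {g : G | ∃ h : G', ∀ i, χ (h + p i g) = l} := by
  by_contra! hcon
  simp only [IsIPStar, not_forall] at hcon
  choose u hu using hcon
  -- Each pair (map, color) gives a polynomial mapping on the product group.
  have hrec := isIPRecurrent_range
    (fun (t : Fin k × Fin r) (v : Fin r → G) => p t.1 (v t.2))
    (fun t => (hp t.1).imp fun d hd => hd.comp_addMonoidHom (Pi.evalAddMonoidHom (fun _ : Fin r => G) t.2))
    (fun t => hp0 t.1)
  obtain ⟨N, F, -, h⟩ := hrec r (fun j l => u l j)
  obtain ⟨x, -, g, ⟨γ, -, hne, rfl⟩, hx⟩ := h χ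
  refine hu (χ x) ⟨∑ j ∈ γ, u (χ x) j, ⟨x, fun i => ?_⟩, γ, hne, rfl⟩
  simpa using hx _ ⟨(i, χ x), rfl⟩
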